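/- Let $R$ be an associative ring with identity whose additive group is torsion-free, and let $a,b\in R$ satisfy $a^2=b^2=0$, so that $1+a$ and $1+b$ are units of $R$. Regard $R$ as a subring of $\mathbb{Q}\otimes_{\mathbb{Z}}R$. By an eigenvalue of an element $x\in R$ we mean a complex number that is an eigenvalue of the $\mathbb{C}$-linear map $y\mapsto (1\otimes x)y$ on $\mathbb{C}\otimes_{\mathbb{Z}}R$ (for $x$ algebraic over $\mathbb{Q}$ these are exactly the complex roots of its minimal polynomial over $\mathbb{Q}$). A complex number $\lambda$ is called a free point if the group generated by the matrices $$e_{12}(1)=\begin{pmatrix}1&1\\0&1\end{pmatrix},\qquad e_{21}(\lambda)=\begin{pmatrix}1&0\\ \lambda&1\end{pmatrix}$$ in $GL_2(\mathbb{C})$ is a free group of rank $2$. Then the subgroup $\langle 1+a,\,1+b\rangle$ of the unit group of $R$ is a free group of rank $2$ if and only if either $ab$ is transcendental over $\mathbb{Q}$, or $ab$ is algebraic over $\mathbb{Q}$ and at least one eigenvalue $\lambda$ of $ab$ is a free point. -/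

import Mathlib

open scoped TensorProduct

namespace SquareZero

/-- The unit `1 + x` of a ring, for an element `x` with `x ^ 2 = 0`; its inverse is `1 - x`. -/
def oneAdd {R : Type*} [Ring R] (x : R) (hx : x ^ 2 = 0) : Rˣ where
  val := 1 + x
  inv := 1 - x
  val_inv := by
    have h : (1 + x) * (1 - x) = 1 - x ^ 2 := by noncomm_ring
    rw [h, hx, sub_zero]
  inv_val := by
    have h : (1 - x) * (1 + x) = 1 - x ^ 2 := by noncomm_ring
    rw [h, hx, sub_zero]

/-- A group is free of rank two if it is isomorphic to the free group on two letters. -/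
def IsFreeOfRankTwo (G : Type*) [Group G] : Prop :=
  Nonempty (G ≃* FreeGroup (Fin 2))

theorem single_sq_eq_zero {R : Type*} [Ring R] {n : ℕ} {i j : Fin n} (hij : i ≠ j) (r : R) :
    Matrix.single i j r ^ 2 = 0 := by
  rw [sq, Matrix.single_mul_single_of_ne]
  exact hij.symm

/-- The unipotent matrix `e_{ij}(r) = 1 + r E_{ij}` (for `i ≠ j`), as an invertible matrix. -/
def unipotent {R : Type*} [Ring R] {n : ℕ} (i j : Fin n) (hij : i ≠ j) (r : R) :
    (Matrix (Fin n) (Fin n) R)ˣ :=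
  oneAdd (Matrix.single i j r) (single_sq_eq_zero hij r)

/-- A complex number `z` is a free point if the matrices `e_{12}(1)` and `e_{21}(z)` generate a
free group of rank two. -/
def IsFreePoint (z : ℂ) : Prop :=
  IsFreeOfRankTwo (Subgroup.closure
    ({unipotent (0 : Fin 2) 1 (by decide) (1 : ℂ), unipotent (1 : Fin 2) 0 (by decide) z} :
      Set (Matrix (Fin 2) (Fin 2) ℂ)ˣ))

/-- An element `x` of a ring `R` is algebraic over `ℚ`: its image in `ℚ ⊗ R` is a root of a
nonzero polynomial with rational coefficients. -/
def IsAlgebraicOverRat {R : Type*} [Ring R] (x : R) : Prop :=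
  IsAlgebraic ℚ ((1 : ℚ) ⊗ₜ[ℤ] x : ℚ ⊗[ℤ] R)

/-- An element `x` of a ring `R` is transcendental over `ℚ`. -/
def IsTranscendentalOverRat {R : Type*} [Ring R] (x : R) : Prop :=
  Transcendental ℚ ((1 : ℚ) ⊗ₜ[ℤ] x : ℚ ⊗[ℤ] R)

/-- The complex number `z` is an eigenvalue of `x ∈ R`: it is an eigenvalue of the left
multiplication by `x` on `ℂ ⊗ R` (the complexified regular representation). -/
def IsEigenvalue {R : Type*} [Ring R] (x : R) (z : ℂ) : Prop :=
  Module.End.HasEigenvalue (LinearMap.mulLeft ℂ ((1 : ℂ) ⊗ₜ[ℤ] x : ℂ ⊗[ℤ] R)) z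

end SquareZero

/-! Since `a² = b² = 0`, a word `w` in `1 + a`, `1 + b` equals `1 + P(ab)ab + Q(ab)a + bR(ab) +
bS(ab)a`, where the polynomials depend on `w` alone and also give the entries of `w` in `e₁₂(1)`,
`e₂₁(X)` (`exists_expansion`). So relations between `1 + a` and `1 + b` are governed by the
polynomials that annihilate `ab`.

If `w(a, b) = 1`, then `P`, `Q`, `R`, `S` times powers of `X` annihilate `ab`, hence vanish at every
eigenvalue `z`. For a free point `z ≠ 0` this forces `w = 1`. If `ab` is transcendental, the
polynomials are zero and the free point 4 serves.

Conversely, suppose no eigenvalue is free. Each root `z` of the minimal polynomial gives a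
nontrivial normal subgroup of words congruent to 1 modulo `X - z`. Commutators multiply moduli, and
nontrivial normal subgroups of a free group have nontrivial commutator. Hence some `w ≠ 1` is
congruent to 1 modulo the whole minimal polynomial, and `w(a, b) = 1`. -/

namespace SquareZero

/-! ### Words in two unipotent units and their functoriality -/

section PairHom

variable {R S : Type*} [Ring R] [Ring S]

theorem oneAdd_zpow_val (a : R) (ha : a ^ 2 = 0) (n : ℤ) :
    ((oneAdd a ha ^ n : Rˣ) : R) = 1 + (n : R) * a := by
  have haa : a * a = 0 := by rw [← sq, ha]
  have hn (m : ℤ) : ((m : R) * a) * a = 0 := by rw [mul_assoc, haa, mul_zero]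
  have hinv : (((oneAdd a ha)⁻¹ : Rˣ) : R) = 1 - a := rfl
  have hval : ((oneAdd a ha : Rˣ) : R) = 1 + a := rfl
  induction n with
  | zero => simp
  | succ n ih =>
    rw [zpow_add_one, Units.val_mul, ih, hval, add_mul, mul_add, mul_add, hn]
    push_cast
    noncomm_ring
  | pred n ih =>
    rw [zpow_sub_one, Units.val_mul, ih, hinv, add_mul, mul_sub, mul_sub, hn]
    push_cast
    noncomm_ring

/-- The homomorphism from the free group on two letters with images `1 + a` and `1 + b`. -/
def pairHom (a b : R) (ha : a ^ 2 = 0) (hb : b ^ 2 = 0) : FreeGroup (Fin 2) →* Rˣ :=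
  FreeGroup.lift ![oneAdd a ha, oneAdd b hb]

theorem map_pairHom (f : R →+* S) {a b : R} (ha : a ^ 2 = 0) (hb : b ^ 2 = 0)
    {a' b' : S} (ha' : a' ^ 2 = 0) (hb' : b' ^ 2 = 0) (hfa : f a = a') (hfb : f b = b')
    (w : FreeGroup (Fin 2)) :
    f (pairHom a b ha hb w : R) = (pairHom a' b' ha' hb' w : S) := by
  have h : (Units.map (f : R →* S)).comp (pairHom a b ha hb) = pairHom a' b' ha' hb' := by
    ext i
    fin_cases i <;> simp [pairHom, oneAdd, hfa, hfb]
  rw [← h]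
  rfl

/-- The homomorphism from the free group on two letters with images `e₁₂(1)` and `e₂₁(s)`. -/
abbrev unipotentHom (s : R) : FreeGroup (Fin 2) →* (Matrix (Fin 2) (Fin 2) R)ˣ :=
  pairHom (Matrix.single 0 1 1) (Matrix.single 1 0 s) (single_sq_eq_zero (by decide) _)
    (single_sq_eq_zero (by decide) _)

theorem map_unipotentHom (f : R →+* S) (s : R) (w : FreeGroup (Fin 2)) :
    (unipotentHom s w : Matrix (Fin 2) (Fin 2) R).map f = (unipotentHom (f s) w : Matrix _ _ S) :=
  map_pairHom (f.mapMatrix (m := Fin 2)) (single_sq_eq_zero (by decide) (1 : R))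
    (single_sq_eq_zero (by decide) s) (single_sq_eq_zero (by decide) (1 : S))
    (single_sq_eq_zero (by decide) (f s))
    (by ext i j; simp [Matrix.single_apply, apply_ite f])
    (by ext i j; simp [Matrix.single_apply, apply_ite f]) w

theorem unipotentHom_injective_map (f : R →+* S) (hf : Function.Injective f) (s : R)
    (h : Function.Injective (unipotentHom s)) : Function.Injective (unipotentHom (f s)) := by
  rw [injective_iff_map_eq_one] at h ⊢
  intro w hw
  apply h
  ext1
  apply Matrix.map_injective hf
  beta_reduce
  rw [map_unipotentHom, hw]
  simp

end PairHom

/-! ### Ping-pong: 4 is a free point -/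

section PingPong

/-- Ping-pong on `ℤ²` with the cones `|v₁| < 2|v₀|` and `2|v₀| < |v₁|`: nonzero powers of `e₁₂(1)`
send the second into the first, those of `e₂₁(4)` the first into the second. -/
theorem unipotentHom_four_injective : Function.Injective (unipotentHom (4 : ℤ)) := by
  let act : (Matrix (Fin 2) (Fin 2) ℤ)ˣ →* (Module.End ℤ (Fin 2 → ℤ))ˣ :=
    Units.map (Matrix.toLinAlgEquiv' : _ ≃ₐ[ℤ] Module.End ℤ (Fin 2 → ℤ)).toMonoidHom
  have hact (m) (v : Fin 2 → ℤ) : act m • v = (m : Matrix _ _ ℤ).mulVec v := rfl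
  let g : Fin 2 → (Matrix (Fin 2) (Fin 2) ℤ)ˣ :=
    ![unipotent 0 1 (by decide) 1, unipotent 1 0 (by decide) 4]
  let X : Fin 2 → Set (Fin 2 → ℤ) := ![{v | |v 1| < 2 * |v 0|}, {v | 2 * |v 0| < |v 1|}]
  let f : ∀ _ : Fin 2, FreeGroup Unit →* (Module.End ℤ (Fin 2 → ℤ))ˣ :=
    fun i => FreeGroup.lift fun _ => act (g i)
  have hlift : act.comp (unipotentHom (4 : ℤ)) =
      (Monoid.CoprodI.lift f).comp (@freeGroupEquivCoprodI (Fin 2)).toMonoidHom := by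
    ext1 i
    fin_cases i <;> simp [pairHom, f, g, unipotent]
  have key : Function.Injective (Monoid.CoprodI.lift f) := by
    apply Monoid.CoprodI.lift_injective_of_ping_pong f (X := X)
    -- Ping-pong with two factors requires one of them to have at least three elements; here it is
    -- infinite cyclic.
    · right
      use 0
      have := Cardinal.mk_congr FreeGroup.freeGroupUnitEquivInt
      rw [this]
      exact le_trans (Cardinal.natCast_lt_aleph0 (n := 3)).le (by simp)
    · intro i
      fin_cases i
      · exact ⟨![1, 0], by simp [X]⟩
      · exact ⟨![0, 1], by simp [X]⟩
    · intro i j hij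
      rw [Function.onFun, Set.disjoint_left]
      fin_cases i <;> fin_cases j <;> simp_all [X] <;> intros <;> linarith
    · intro i j hij h hh
      obtain ⟨n, rfl⟩ : ∃ n : ℤ, FreeGroup.of () ^ n = h :=
        ⟨_, FreeGroup.freeGroupUnitEquivInt.symm_apply_apply h⟩
      have hn : n ≠ 0 := by rintro rfl; simp at hh
      have hn1 : 1 ≤ |n| := Int.one_le_abs hn
      rintro _ ⟨v, hv, rfl⟩
      have h0 : f i (FreeGroup.of () ^ n) • v = ((g i ^ n : _ˣ) : Matrix _ _ ℤ).mulVec v := by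
        rw [← hact, map_zpow, map_zpow]
        simp [f]
      simp only [h0]
      fin_cases i <;> fin_cases j <;> first | exact absurd rfl hij | skip
      · have hv' : 2 * |v 0| < |v 1| := hv
        have h1 : |v 1| ≤ |n * v 1| := by
          rw [abs_mul]; exact le_mul_of_one_le_left (abs_nonneg _) hn1
        have h2 := abs_sub (v 0 + n * v 1) (v 0)
        rw [add_sub_cancel_left] at h2
        suffices |v 1| < 2 * |v 0 + n * v 1| by
          simpa [X, g, unipotent, oneAdd_zpow_val, Matrix.add_mulVec, Matrix.mulVec, dotProduct,
            Matrix.one_apply, Matrix.single_apply, ← Matrix.diagonal_intCast,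
            Matrix.vecHead, Matrix.vecTail] using this
        linarith
      · have hv' : |v 1| < 2 * |v 0| := hv
        have h1 : |v 0| ≤ |n * v 0| := by
          rw [abs_mul]; exact le_mul_of_one_le_left (abs_nonneg _) hn1
        have h2 := abs_sub (v 1 + 4 * (n * v 0)) (v 1)
        rw [add_sub_cancel_left, abs_mul, abs_of_nonneg (by norm_num : (0 : ℤ) ≤ 4)] at h2
        suffices 2 * |v 0| < |v 1 + n * 4 * v 0| by
 
          simpa [X, g, unipotent, oneAdd_zpow_val, Matrix.add_mulVec, Matrix.mulVec, dotProduct,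
            Matrix.one_apply, Matrix.single_apply, ← Matrix.diagonal_intCast,
            Matrix.vecHead, Matrix.vecTail] using this
        rw [show n * 4 * v 0 = 4 * (n * v 0) by ring]
        linarith
  have := key.comp (freeGroupEquivCoprodI (ι := Fin 2)).injective
  apply Function.Injective.of_comp (f := act)
  rw [← MonoidHom.coe_comp, hlift]
  exact this

end PingPong

/-! ### Residual finiteness and the Hopf property -/

section Hopf

/-- The free group on two letters is residually finite. -/
theorem exists_finite_quotient (w : FreeGroup (Fin 2)) (hw : w ≠ 1) :
    ∃ (Q : Type) (_ : Group Q) (_ : Finite Q) (π : FreeGroup (Fin 2) →* Q), π w ≠ 1 := by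
  have h1 : (unipotentHom (4 : ℤ) w : Matrix (Fin 2) (Fin 2) ℤ) ≠ 1 := by
    intro h
    exact hw ((injective_iff_map_eq_one _).1 unipotentHom_four_injective w (Units.ext h))
  obtain ⟨i, j, hij⟩ : ∃ i j, ((unipotentHom (4 : ℤ) w : Matrix (Fin 2) (Fin 2) ℤ) - 1) i j ≠ 0 := by
    by_contra! h
    exact h1 (sub_eq_zero.1 (Matrix.ext h))
  obtain ⟨d, hd⟩ : ∃ d, ((unipotentHom (4 : ℤ) w : Matrix (Fin 2) (Fin 2) ℤ) - 1) i j = d :=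
    ⟨_, rfl⟩
  rw [hd] at hij
  -- The nonzero entry `d` survives modulo `|d| + 1`.
  refine ⟨(Matrix (Fin 2) (Fin 2) (ZMod (d.natAbs + 1)))ˣ, inferInstance, inferInstance,
    unipotentHom ((Int.castRingHom _) 4), fun h => ?_⟩
  have h2 := map_unipotentHom (Int.castRingHom (ZMod (d.natAbs + 1))) 4 w
  have h3 : (d : ZMod (d.natAbs + 1)) = 0 := by
    have h4 : ((unipotentHom (4 : ℤ) w : Matrix (Fin 2) (Fin 2) ℤ) - 1).map
        (Int.castRingHom (ZMod (d.natAbs + 1))) = 0 := by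
      rw [Matrix.map_sub _ (map_sub _), h2, h, Matrix.map_one _ (map_zero _) (map_one _)]
      exact sub_self _
    have h5 := congrFun (congrFun h4 i) j
    rw [Matrix.map_apply, hd] at h5
    exact h5
  rw [ZMod.intCast_zmod_eq_zero_iff_dvd, Int.natCast_dvd] at h3
  have := Nat.le_of_dvd (Int.natAbs_pos.2 hij) h3
  omega

/-- The free group on two letters is Hopfian. -/
theorem injective_of_surjective_endomorphism (φ : FreeGroup (Fin 2) →* FreeGroup (Fin 2))
    (hφ : Function.Surjective φ) : Function.Injective φ := by
  rw [injective_iff_map_eq_one]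
  intro w hw
  by_contra hne
  obtain ⟨Q, _, _, π, hπ⟩ := exists_finite_quotient w hne
  have : Finite (FreeGroup (Fin 2) →* Q) := Finite.of_equiv _ (FreeGroup.lift (α := Fin 2) (β := Q))
  -- Precomposition with `φ` is an injective self-map of a finite set, so `π` factors through `φ`
  -- and kills `w`.
  have hinj : Function.Injective fun ψ : FreeGroup (Fin 2) →* Q => ψ.comp φ :=
    fun ψ₁ ψ₂ h => (MonoidHom.cancel_right hφ).1 h
  obtain ⟨ψ, rfl⟩ := (Finite.injective_iff_surjective.1 hinj) π
  exact hπ (by simp [hw])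

/-- An abstract isomorphism with the free group need not match generators; the Hopf property shows
that `u`, `v` are nevertheless free generators. -/
theorem isFreeOfRankTwo_closure_pair_iff {G : Type*} [Group G] (u v : G) :
    IsFreeOfRankTwo (Subgroup.closure ({u, v} : Set G)) ↔
      Function.Injective (FreeGroup.lift ![u, v]) := by
  have hr : (FreeGroup.lift ![u, v]).range = Subgroup.closure ({u, v} : Set G) := by
    rw [FreeGroup.range_lift_eq_closure]
    simp [Set.pair_comm]
  rw [← hr]
  constructor
  · rintro ⟨e⟩
    have h := injective_of_surjective_endomorphism
      (e.toMonoidHom.comp (FreeGroup.lift ![u, v]).rangeRestrict)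
      (e.surjective.comp (MonoidHom.rangeRestrict_surjective _))
    have h' : Function.Injective (FreeGroup.lift ![u, v]).rangeRestrict :=
      Function.Injective.of_comp (f := e) h
    exact (MonoidHom.rangeRestrict_injective_iff).1 h'
  · intro h
    exact ⟨(MonoidHom.ofInjective h).symm⟩

theorem isFreeOfRankTwo_closure_oneAdd_iff {R : Type*} [Ring R] (a b : R)
    (ha : a ^ 2 = 0) (hb : b ^ 2 = 0) :
    IsFreeOfRankTwo (Subgroup.closure ({oneAdd a ha, oneAdd b hb} : Set Rˣ)) ↔
      Function.Injective (pairHom a b ha hb) :=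
  isFreeOfRankTwo_closure_pair_iff _ _

theorem isFreePoint_iff (z : ℂ) : IsFreePoint z ↔ Function.Injective (unipotentHom z) :=
  isFreeOfRankTwo_closure_pair_iff _ _

theorem isFreePoint_four : IsFreePoint 4 := by
  rw [isFreePoint_iff]
  simpa using unipotentHom_injective_map (Int.castRingHom ℂ) Int.cast_injective 4
    unipotentHom_four_injective

theorem IsFreePoint.ne_zero {z : ℂ} (hz : IsFreePoint z) : z ≠ 0 := by
  rintro rfl
  rw [isFreePoint_iff] at hz
  have h : FreeGroup.of (1 : Fin 2) = 1 := by
    apply hz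
    ext1
    simp [pairHom, oneAdd]
  exact FreeGroup.of_ne_one _ h

end Hopf

/-! ### Commutators of normal subgroups of the free group -/

section Commutators

theorem unipotentHom_of_zero {R : Type*} [Ring R] (s : R) :
    (unipotentHom s (FreeGroup.of 0) : Matrix (Fin 2) (Fin 2) R) = !![1, 1; 0, 1] := by
  ext i j
  fin_cases i <;> fin_cases j <;> simp [pairHom, oneAdd]

theorem unipotentHom_of_one {R : Type*} [Ring R] (s : R) :
    (unipotentHom s (FreeGroup.of 1) : Matrix (Fin 2) (Fin 2) R) = !![1, 0; s, 1] := by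
  ext i j
  fin_cases i <;> fin_cases j <;> simp [pairHom, oneAdd]

theorem unipotentHom_of_zero_inv {R : Type*} [Ring R] (s : R) :
    (unipotentHom s (FreeGroup.of 0)⁻¹ : Matrix (Fin 2) (Fin 2) R) = !![1, -1; 0, 1] := by
  have : (unipotentHom s (FreeGroup.of 0)⁻¹ : Matrix (Fin 2) (Fin 2) R) =
    1 - Matrix.single 0 1 1 := by simp [pairHom]; rfl
  rw [this]
  ext i j
  fin_cases i <;> fin_cases j <;> simp

theorem unipotentHom_of_one_inv {R : Type*} [Ring R] (s : R) :
    (unipotentHom s (FreeGroup.of 1)⁻¹ : Matrix (Fin 2) (Fin 2) R) = !![1, 0; -s, 1] := by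
  have : (unipotentHom s (FreeGroup.of 1)⁻¹ : Matrix (Fin 2) (Fin 2) R) =
    1 - Matrix.single 1 0 s := by simp [pairHom]; rfl
  rw [this]
  ext i j
  fin_cases i <;> fin_cases j <;> simp

/-- Invertibility gives `p = ±1`, so `w² = 1`, and free groups are torsion-free. -/
theorem eq_one_of_unipotentHom_eq_scalar (w : FreeGroup (Fin 2)) (p : ℤ)
    (h : (unipotentHom (4 : ℤ) w : Matrix (Fin 2) (Fin 2) ℤ) = !![p, 0; 0, p]) : w = 1 := by
  have h1 : (unipotentHom (4 : ℤ) w : Matrix (Fin 2) (Fin 2) ℤ) *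
      (unipotentHom (4 : ℤ) w⁻¹ : Matrix (Fin 2) (Fin 2) ℤ) = 1 := by
    rw [← Units.val_mul, ← map_mul]; simp
  have h2 := congrFun (congrFun h1 0) 0
  rw [h, Matrix.mul_apply, Fin.sum_univ_two] at h2
  have h3 : p * p = 1 := by
    have : p = 1 ∨ p = -1 := Int.isUnit_iff.1 (IsUnit.of_mul_eq_one _ (by simpa using h2))
    rcases this with rfl | rfl <;> rfl
  have h4 : w ^ 2 = 1 := by
    apply unipotentHom_four_injective
    ext1
    rw [sq, map_mul, Units.val_mul, h, map_one, Units.val_one, Matrix.mul_fin_two]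
    simp [h3, Matrix.one_fin_two]
  exact (pow_eq_one_iff_left two_ne_zero).1 h4

/-- If the entry vanished on all of `N`, conjugating by `e₂₁(±4)` would force every matrix from `N`
to be scalar. -/
theorem exists_mem_lowerLeft_ne_zero (N : Subgroup (FreeGroup (Fin 2))) [N.Normal] (hN : N ≠ ⊥) :
    ∃ w ∈ N, (unipotentHom (4 : ℤ) w : Matrix (Fin 2) (Fin 2) ℤ) 1 0 ≠ 0 := by
  by_contra! h
  obtain ⟨⟨w, hwN⟩, hw1⟩ := Subgroup.ne_bot_iff_exists_ne_one.1 hN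
  apply hw1
  ext1
  have e0 := h w hwN
  have e1 := h _ (‹N.Normal›.conj_mem w hwN (FreeGroup.of 1))
  have e2 := h _ (‹N.Normal›.conj_mem w hwN (FreeGroup.of 1)⁻¹)
  rw [inv_inv] at e2
  simp only [map_mul, Units.val_mul, unipotentHom_of_one, unipotentHom_of_one_inv] at e1 e2
  refine eq_one_of_unipotentHom_eq_scalar w
    ((unipotentHom (4 : ℤ) w : Matrix (Fin 2) (Fin 2) ℤ) 0 0) ?_
  generalize (unipotentHom (4 : ℤ) w : Matrix (Fin 2) (Fin 2) ℤ) = M at *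
  rw [Matrix.eta_fin_two M] at e1 e2
  simp at e1 e2
  ext i j
  fin_cases i <;> fin_cases j <;> simp <;> linarith

/-- Otherwise `w₁` commutes with the conjugates of `w₂` by `e₁₂(t)`, `t = 0, ±1`. The upper left
entries of these relations are quadratic in `t`; their second difference says that the product of
the lower left entries is zero. -/
theorem commutator_ne_bot (N₁ N₂ : Subgroup (FreeGroup (Fin 2))) [N₁.Normal] [N₂.Normal]
    (h₁ : N₁ ≠ ⊥) (h₂ : N₂ ≠ ⊥) : ⁅N₁, N₂⁆ ≠ ⊥ := by
  intro h
  rw [Subgroup.commutator_eq_bot_iff_le_centralizer] at h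
  obtain ⟨w₁, hw₁, hc₁⟩ := exists_mem_lowerLeft_ne_zero N₁ h₁
  obtain ⟨w₂, hw₂, hc₂⟩ := exists_mem_lowerLeft_ne_zero N₂ h₂
  have hcomm (g) (hg : g ∈ N₂) : (unipotentHom (4 : ℤ) g : Matrix (Fin 2) (Fin 2) ℤ) *
      (unipotentHom (4 : ℤ) w₁ : Matrix (Fin 2) (Fin 2) ℤ) =
      (unipotentHom (4 : ℤ) w₁ : Matrix (Fin 2) (Fin 2) ℤ) *
      (unipotentHom (4 : ℤ) g : Matrix (Fin 2) (Fin 2) ℤ) := by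
    rw [← Units.val_mul, ← map_mul, Subgroup.mem_centralizer_iff.1 (h hw₁) g hg, map_mul,
      Units.val_mul]
  have e0 := hcomm _ hw₂
  have e1 := hcomm _ (‹N₂.Normal›.conj_mem w₂ hw₂ (FreeGroup.of 0))
  have e2 := hcomm _ (‹N₂.Normal›.conj_mem w₂ hw₂ (FreeGroup.of 0)⁻¹)
  rw [inv_inv] at e2
  simp only [map_mul, Units.val_mul, unipotentHom_of_zero, unipotentHom_of_zero_inv] at e1 e2
  generalize (unipotentHom (4 : ℤ) w₁ : Matrix (Fin 2) (Fin 2) ℤ) = M at *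
  generalize (unipotentHom (4 : ℤ) w₂ : Matrix (Fin 2) (Fin 2) ℤ) = M' at *
  rw [Matrix.eta_fin_two M', Matrix.eta_fin_two M] at e0 e1 e2
  simp only [Matrix.mul_fin_two] at e0 e1 e2
  have e0 := congrFun (congrFun e0 0) 0
  have e1 := congrFun (congrFun e1 0) 0
  have e2 := congrFun (congrFun e2 0) 0
  simp at e0 e1 e2
  have : M 1 0 * M' 1 0 = 0 := by linarith
  simp_all

end Commutators

open Polynomial

/-! ### Expansion of words as polynomials in `ab` -/

section Expansion

variable {k K : Type*} [CommRing k] [Ring K] [Algebra k K]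

/-- The element `P(ab)ab + Q(ab)a + bR(ab) + bS(ab)a`. -/
noncomputable def wordEval (a b : K) (P Q R S : k[X]) : K :=
  aeval (a * b) (P * X) + aeval (a * b) Q * a + b * aeval (a * b) R + b * aeval (a * b) S * a

variable {a b : K}

theorem mul_aeval_mul (ha : a ^ 2 = 0) (p : k[X]) :
    a * aeval (a * b) p = p.coeff 0 • a := by
  have haa : a * a = 0 := by rw [← sq, ha]
  have h := congrArg (aeval (a * b)) (X_mul_divX_add p)
  rw [map_add, map_mul, aeval_X, aeval_C] at h
  rw [← h, mul_add, ← mul_assoc, ← mul_assoc, haa, zero_mul, zero_mul, zero_add, Algebra.smul_def,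
    Algebra.commutes]

theorem aeval_mul_mul (hb : b ^ 2 = 0) (p : k[X]) :
    aeval (a * b) p * b = p.coeff 0 • b := by
  have hbb : b * b = 0 := by rw [← sq, hb]
  conv_lhs => rw [← divX_mul_X_add p]
  simp [add_mul, mul_assoc, hbb, Algebra.smul_def]

theorem mul_aeval_mul_assoc (ha : a ^ 2 = 0) (p : k[X]) (y : K) :
    a * (aeval (a * b) p * y) = p.coeff 0 • (a * y) := by
  rw [← mul_assoc, mul_aeval_mul ha, smul_mul_assoc]

theorem aeval_mul_mul_assoc (hb : b ^ 2 = 0) (p : k[X]) (y : K) :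
    aeval (a * b) p * (b * y) = p.coeff 0 • (b * y) := by
  rw [← mul_assoc, aeval_mul_mul hb, smul_mul_assoc]

theorem mul_self_mul_of_sq_eq_zero (ha : a ^ 2 = 0) (y : K) : a * (a * y) = 0 := by
  rw [← mul_assoc, ← sq, ha, zero_mul]

theorem mul_self_of_sq_eq_zero (ha : a ^ 2 = 0) : a * a = 0 := by
  rw [← sq, ha]

/-- Since `a·ab = 0` and `ab·b = 0`, only constant terms survive in `a p(ab)` and `p(ab) b`. The
result is the multiplication rule of the matrices `wordMatrix`. -/
theorem wordEval_mul (ha : a ^ 2 = 0) (hb : b ^ 2 = 0) (P Q R S P' Q' R' S' : k[X]) :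
    wordEval a b P Q R S * wordEval a b P' Q' R' S' =
      wordEval a b (P * X * P' + Q * R') (P * X * Q' + Q * X * S') (R * P' * X + S * X * R')
        (R * Q' + S * X * S') := by
  have hQR : aeval (a * b) (Q * R' * X) = aeval (a * b) (Q * X * R') := by congr 1; ring
  simp only [wordEval, add_mul _ _ X, map_add, hQR]
  simp only [map_mul, aeval_X, add_mul, mul_add, mul_assoc,
    mul_aeval_mul_assoc ha, aeval_mul_mul_assoc hb, mul_self_mul_of_sq_eq_zero ha,
    mul_self_mul_of_sq_eq_zero hb, mul_self_of_sq_eq_zero ha,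
    mul_smul_comm, smul_zero, mul_zero]
  abel

/-- Each sandwich isolates one of the four coefficients, at the cost of powers of `X`. -/
theorem sandwich_wordEval (ha : a ^ 2 = 0) (hb : b ^ 2 = 0) (P Q R S : k[X]) :
    a * b * wordEval a b P Q R S * (a * b) = aeval (a * b) (X * (P * X) * X) ∧
      a * b * wordEval a b P Q R S * b = aeval (a * b) (X * Q * X) ∧
      a * wordEval a b P Q R S * (a * b) = aeval (a * b) (X * R * X) ∧
      a * wordEval a b P Q R S * b = aeval (a * b) (X * S * X) := by
  refine ⟨?_, ?_, ?_, ?_⟩ <;>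
    simp only [wordEval, map_mul, aeval_X, add_mul, mul_add, mul_assoc,
      aeval_mul_mul hb, mul_aeval_mul_assoc ha,
      mul_self_mul_of_sq_eq_zero ha, mul_self_mul_of_sq_eq_zero hb, mul_self_of_sq_eq_zero ha,
      mul_self_of_sq_eq_zero hb, mul_smul_comm, smul_zero, mul_zero, zero_add, add_zero]

theorem wordEval_add (P Q R S P' Q' R' S' : k[X]) :
    wordEval a b P Q R S + wordEval a b P' Q' R' S' =
      wordEval a b (P + P') (Q + Q') (R + R') (S + S') := by
  simp only [wordEval, add_mul, mul_add, map_add]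
  abel

/-- The matrix that corresponds to `P(ab)ab + Q(ab)a + bR(ab) + bS(ab)a` for the pair
`a = E₁₂`, `b = X E₂₁`. -/
noncomputable def wordMatrix (P Q R S : k[X]) : Matrix (Fin 2) (Fin 2) k[X] :=
  !![X * P, Q; X * R, X * S]

theorem exists_expansion (k : Type*) [CommRing k] [Algebra k K] (ha : a ^ 2 = 0) (hb : b ^ 2 = 0)
    (w : FreeGroup (Fin 2)) :
    ∃ P Q R S : k[X], (pairHom a b ha hb w : K) = 1 + wordEval a b P Q R S ∧
      (unipotentHom (X : k[X]) w : Matrix (Fin 2) (Fin 2) k[X]) = 1 + wordMatrix P Q R S := by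
  induction w using FreeGroup.induction_on with
  | C1 =>
    exact ⟨0, 0, 0, 0, by simp [wordEval], by
      ext i j; fin_cases i <;> fin_cases j <;> simp [wordMatrix]⟩
  | of i =>
    fin_cases i
    · exact ⟨0, 1, 0, 0, by simp [wordEval, pairHom, oneAdd], by
        simp only [Fin.zero_eta, unipotentHom_of_zero]
        ext i j; fin_cases i <;> fin_cases j <;> simp [wordMatrix]⟩
    · exact ⟨0, 0, 1, 0, by simp [wordEval, pairHom, oneAdd], by
        simp only [Fin.mk_one, unipotentHom_of_one]
        ext i j; fin_cases i <;> fin_cases j <;> simp [wordMatrix]⟩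
  | inv_of i _ =>
    fin_cases i
    · refine ⟨0, -1, 0, 0, ?_, ?_⟩
      · simp [wordEval, pairHom, ← sub_eq_add_neg]; rfl
      · simp only [Fin.zero_eta, unipotentHom_of_zero_inv]
        ext i j; fin_cases i <;> fin_cases j <;> simp [wordMatrix]
    · refine ⟨0, 0, -1, 0, ?_, ?_⟩
      · simp [wordEval, pairHom, ← sub_eq_add_neg]; rfl
      · simp only [Fin.mk_one, unipotentHom_of_one_inv]
        ext i j; fin_cases i <;> fin_cases j <;> simp [wordMatrix]
  | mul v w hv hw =>
    obtain ⟨P, Q, R, S, h, hM⟩ := hv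
    obtain ⟨P', Q', R', S', h', hM'⟩ := hw
    refine ⟨P + P' + (P * X * P' + Q * R'), Q + Q' + (P * X * Q' + Q * X * S'),
      R + R' + (R * P' * X + S * X * R'), S + S' + (R * Q' + S * X * S'), ?_, ?_⟩
    · rw [map_mul, Units.val_mul, h, h', ← wordEval_add, ← wordEval_add, ← wordEval_mul ha hb]
      noncomm_ring
    · rw [map_mul, Units.val_mul, hM, hM']
      ext1 i j
      fin_cases i <;> fin_cases j <;> simp [wordMatrix, Matrix.one_fin_two] <;> ring

end Expansion

/-! ### A free point forces freeness -/

section Sufficiency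

theorem pairHom_injective_of_isFreePoint {K : Type*} [Ring K] {a b : K} (ha : a ^ 2 = 0)
    (hb : b ^ 2 = 0) {z : ℂ} (hz : IsFreePoint z)
    (h : ∀ g : ℤ[X], aeval (a * b) g = 0 → aeval z g = 0) :
    Function.Injective (pairHom a b ha hb) := by
  have hz0 := hz.ne_zero
  rw [isFreePoint_iff, injective_iff_map_eq_one] at hz
  rw [injective_iff_map_eq_one]
  intro w hw
  obtain ⟨P, Q, R, S, hE, hM⟩ := exists_expansion ℤ ha hb w
  have hE0 : wordEval a b P Q R S = 0 := by simpa [hw] using hE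
  obtain ⟨hP, hQ, hR, hS⟩ := sandwich_wordEval ha hb P Q R S
  rw [hE0, mul_zero, zero_mul] at hP hQ hR hS
  replace hP := h _ hP.symm
  replace hQ := h _ hQ.symm
  replace hR := h _ hR.symm
  replace hS := h _ hS.symm
  simp only [map_mul, aeval_X, mul_eq_zero, hz0, or_false, false_or] at hP hQ hR hS
  apply hz
  ext1
  have hmap := map_unipotentHom (aeval z : ℤ[X] →ₐ[ℤ] ℂ).toRingHom X w
  simp only [AlgHom.toRingHom_eq_coe, RingHom.coe_coe, aeval_X] at hmap
  rw [← hmap, hM]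
  ext i j
  fin_cases i <;> fin_cases j <;> simp [wordMatrix, hP, hQ, hR, hS]

end Sufficiency

/-! ### Congruence subgroups of words over `k[X]` -/

section Congruence

variable {k : Type*} [CommRing k]

/-- The matrices over `k[X]` whose entries are divisible by the given polynomials. -/
def divisibleBy (d : Matrix (Fin 2) (Fin 2) k[X]) : AddSubgroup (Matrix (Fin 2) (Fin 2) k[X]) where
  carrier := {M | ∀ i j, d i j ∣ M i j}
  zero_mem' _ _ := dvd_zero _
  add_mem' h h' i j := dvd_add (h i j) (h' i j)
  neg_mem' h i j := (dvd_neg).2 (h i j)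

theorem mul_mem_divisibleBy {d d' e M M' : Matrix (Fin 2) (Fin 2) k[X]}
    (he : ∀ i l j, e i j ∣ d i l * d' l j) (hM : M ∈ divisibleBy d) (hM' : M' ∈ divisibleBy d') :
    M * M' ∈ divisibleBy e := fun i j => by
  rw [Matrix.mul_apply]
  exact Finset.dvd_sum fun l _ => (he i l j).trans (mul_dvd_mul (hM i l) (hM' l j))

/-- The pattern of divisibility of the matrices `w - 1`, for words `w` in `e₁₂(1)`, `e₂₁(X)`. -/
noncomputable def wordPattern (k : Type*) [CommRing k] : Matrix (Fin 2) (Fin 2) k[X] := !![X, 1; X, X]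

theorem wordPattern_dvd (i l j : Fin 2) :
    wordPattern k i j ∣ wordPattern k i l * wordPattern k l j := by
  fin_cases i <;> fin_cases j <;> fin_cases l <;> simp [wordPattern]

theorem unipotentHom_sub_one_mem (w : FreeGroup (Fin 2)) :
    (unipotentHom (X : k[X]) w : Matrix (Fin 2) (Fin 2) k[X]) - 1 ∈
      divisibleBy (wordPattern k) := by
  obtain ⟨P, Q, R, S, -, h⟩ := exists_expansion (a := (0 : k)) (b := 0) k (by simp) (by simp) w
  rw [h, add_sub_cancel_left]
  intro i j
  fin_cases i <;> fin_cases j <;> simp [wordPattern, wordMatrix]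

/-- A pattern of divisibility is stable if the matrices that obey it form an ideal in the ring
generated by `e₁₂(1)` and `e₂₁(X)`. -/
def IsStablePattern (d : Matrix (Fin 2) (Fin 2) k[X]) : Prop :=
  ∀ i l j, d i j ∣ wordPattern k i l * d l j ∧ d i j ∣ d i l * wordPattern k l j

theorem IsStablePattern.mul_left {d : Matrix (Fin 2) (Fin 2) k[X]} (hd : IsStablePattern d)
    (w : FreeGroup (Fin 2)) {M : Matrix (Fin 2) (Fin 2) k[X]} (hM : M ∈ divisibleBy d) :
    (unipotentHom (X : k[X]) w : Matrix (Fin 2) (Fin 2) k[X]) * M ∈ divisibleBy d := by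
  have h := mul_mem_divisibleBy (fun i l j => (hd i l j).1) (unipotentHom_sub_one_mem w) hM
  simpa [sub_mul] using add_mem h hM

theorem IsStablePattern.mul_right {d : Matrix (Fin 2) (Fin 2) k[X]} (hd : IsStablePattern d)
    (w : FreeGroup (Fin 2)) {M : Matrix (Fin 2) (Fin 2) k[X]} (hM : M ∈ divisibleBy d) :
    M * (unipotentHom (X : k[X]) w : Matrix (Fin 2) (Fin 2) k[X]) ∈ divisibleBy d := by
  have h := mul_mem_divisibleBy (fun i l j => (hd i l j).2) hM (unipotentHom_sub_one_mem w)
  simpa [mul_sub] using add_mem h hM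

/-- The words `w` in `e₁₂(1)` and `e₂₁(X)` for which `w - 1` obeys a stable pattern. -/
def congruenceSubgroup (d : Matrix (Fin 2) (Fin 2) k[X]) (hd : IsStablePattern d) :
    Subgroup (FreeGroup (Fin 2)) where
  carrier := {w | (unipotentHom (X : k[X]) w : Matrix (Fin 2) (Fin 2) k[X]) - 1 ∈ divisibleBy d}
  one_mem' := by simp
  mul_mem' {v w} hv hw := by
    have h := add_mem (hd.mul_right w hv) hw
    rw [Set.mem_ofPred_eq, map_mul, Units.val_mul]
    convert h using 1
    noncomm_ring
  inv_mem' {w} hw := by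
    have h := neg_mem (hd.mul_left w⁻¹ hw)
    rw [mul_sub, ← Units.val_mul, ← map_mul, inv_mul_cancel] at h
    simpa using h

theorem mem_congruenceSubgroup {d : Matrix (Fin 2) (Fin 2) k[X]} {hd : IsStablePattern d}
    {w : FreeGroup (Fin 2)} : w ∈ congruenceSubgroup d hd ↔
      (unipotentHom (X : k[X]) w : Matrix (Fin 2) (Fin 2) k[X]) - 1 ∈ divisibleBy d := Iff.rfl

instance congruenceSubgroup_normal (d : Matrix (Fin 2) (Fin 2) k[X]) (hd : IsStablePattern d) :
    (congruenceSubgroup d hd).Normal where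
  conj_mem w hw g := by
    have h := hd.mul_left g (hd.mul_right g⁻¹ hw)
    rw [sub_mul, mul_sub, one_mul, ← Units.val_mul, ← Units.val_mul, ← Units.val_mul, ← map_mul,
      ← map_mul, ← map_mul, mul_inv_cancel, ← mul_assoc] at h
    simpa [mem_congruenceSubgroup] using h

/-- This rests on `vwv⁻¹w⁻¹ - 1 = ((v - 1)(w - 1) - (w - 1)(v - 1))(wv)⁻¹`. -/
theorem commutator_congruenceSubgroup_le {d d' e : Matrix (Fin 2) (Fin 2) k[X]}
    (hd : IsStablePattern d) (hd' : IsStablePattern d') (he : IsStablePattern e)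
    (h : ∀ i l j, e i j ∣ d i l * d' l j ∧ e i j ∣ d' i l * d l j) :
    ⁅congruenceSubgroup d hd, congruenceSubgroup d' hd'⁆ ≤ congruenceSubgroup e he := by
  rw [Subgroup.commutator_le]
  intro v hv w hw
  have h₁ := sub_mem (mul_mem_divisibleBy (fun i l j => (h i l j).1) hv hw)
    (mul_mem_divisibleBy (fun i l j => (h i l j).2) hw hv)
  have h₂ := he.mul_right (w * v)⁻¹ h₁
  rw [mem_congruenceSubgroup]
  have h₃ : ((unipotentHom (X : k[X]) v : Matrix (Fin 2) (Fin 2) k[X]) - 1) *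
      ((unipotentHom (X : k[X]) w : Matrix (Fin 2) (Fin 2) k[X]) - 1) -
      ((unipotentHom (X : k[X]) w : Matrix (Fin 2) (Fin 2) k[X]) - 1) *
      ((unipotentHom (X : k[X]) v : Matrix (Fin 2) (Fin 2) k[X]) - 1) =
      (unipotentHom (X : k[X]) (v * w) : Matrix (Fin 2) (Fin 2) k[X]) -
      (unipotentHom (X : k[X]) (w * v) : Matrix (Fin 2) (Fin 2) k[X]) := by
    rw [map_mul, map_mul, Units.val_mul, Units.val_mul]
    noncomm_ring
  rw [h₃, sub_mul, ← Units.val_mul, ← Units.val_mul, ← map_mul, ← map_mul, mul_inv_cancel] at h₂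
  simpa [commutatorElement_def, mul_assoc] using h₂

theorem isStablePattern_smul (f : k[X]) : IsStablePattern (f • wordPattern k) := fun i l j => by
  have h := mul_dvd_mul_left f (wordPattern_dvd (k := k) i l j)
  constructor
  · simpa only [Matrix.smul_apply, smul_eq_mul, mul_left_comm] using h
  · simpa only [Matrix.smul_apply, smul_eq_mul, mul_assoc] using h

/-- The words `w` in `e₁₂(1)` and `e₂₁(X)` such that `w - 1` is divisible by `f`. -/
noncomputable abbrev levelSubgroup (f : k[X]) : Subgroup (FreeGroup (Fin 2)) :=
  congruenceSubgroup (f • wordPattern k) (isStablePattern_smul f)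

theorem levelSubgroup_one : levelSubgroup (1 : k[X]) = ⊤ := by
  rw [eq_top_iff]
  intro w _
  simpa [mem_congruenceSubgroup] using unipotentHom_sub_one_mem w

theorem commutator_levelSubgroup_le (f g : k[X]) :
    ⁅levelSubgroup f, levelSubgroup g⁆ ≤ levelSubgroup (f * g) := by
  refine commutator_congruenceSubgroup_le _ _ _ fun i l j => ?_
  have h := mul_dvd_mul_left (f * g) (wordPattern_dvd (k := k) i l j)
  simp only [Matrix.smul_apply, smul_eq_mul]
  constructor
  · rwa [mul_mul_mul_comm]
  · rwa [mul_mul_mul_comm, mul_comm g f]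

/-- The pattern of divisibility of the commutators of words in `e₁₂(1)` and `e₂₁(X)`. -/
noncomputable def commutatorPattern (k : Type*) [CommRing k] : Matrix (Fin 2) (Fin 2) k[X] :=
  !![X, X; X ^ 2, X]

theorem isStablePattern_commutatorPattern : IsStablePattern (commutatorPattern k) := by
  intro i l j
  fin_cases i <;> fin_cases j <;> fin_cases l <;>
    simp [commutatorPattern, wordPattern, sq, mul_assoc]

instance : Nontrivial (FreeGroup (Fin 2)) :=
  ⟨FreeGroup.of 0, 1, FreeGroup.of_ne_one _⟩

/-- The root 0 is special because `wordPattern` already contains factors `X`. The second derived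
subgroup gains one more factor in every entry. -/
theorem levelSubgroup_X_ne_bot : levelSubgroup (X : k[X]) ≠ ⊥ := by
  have h₁ : ⁅(⊤ : Subgroup (FreeGroup (Fin 2))), (⊤ : Subgroup (FreeGroup (Fin 2)))⁆ ≤
      congruenceSubgroup (commutatorPattern k) isStablePattern_commutatorPattern := by
    rw [← levelSubgroup_one (k := k)]
    refine commutator_congruenceSubgroup_le _ _ _ fun i l j => ?_
    fin_cases i <;> fin_cases j <;> fin_cases l <;>
      simp [commutatorPattern, wordPattern, sq]
  have h₂ : ⁅⁅(⊤ : Subgroup (FreeGroup (Fin 2))), (⊤ : Subgroup (FreeGroup (Fin 2)))⁆,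
      ⁅(⊤ : Subgroup (FreeGroup (Fin 2))), (⊤ : Subgroup (FreeGroup (Fin 2)))⁆⁆ ≤
      levelSubgroup (X : k[X]) := by
    refine (Subgroup.commutator_mono h₁ h₁).trans ?_
    refine commutator_congruenceSubgroup_le _ _ _ fun i l j => ?_
    fin_cases i <;> fin_cases j <;> fin_cases l <;>
      simp [commutatorPattern, wordPattern, sq, mul_assoc]
  have h₃ : ⁅(⊤ : Subgroup (FreeGroup (Fin 2))), (⊤ : Subgroup (FreeGroup (Fin 2)))⁆ ≠ ⊥ :=
    commutator_ne_bot _ _ top_ne_bot top_ne_bot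
  exact ne_bot_of_le_ne_bot (commutator_ne_bot _ _ h₃ h₃) h₂

/-- For `z ≠ 0`, a relation at `z` makes `X - z` divide `w - 1`; being coprime to `X`, it divides
independently of the pattern. -/
theorem levelSubgroup_X_sub_C_ne_bot {z : ℂ} (hz : ¬ IsFreePoint z) :
    levelSubgroup (X - C z) ≠ ⊥ := by
  by_cases hz0 : z = 0
  · rw [hz0, C_0, sub_zero]
    exact levelSubgroup_X_ne_bot
  rw [isFreePoint_iff, injective_iff_map_eq_one] at hz
  push Not at hz
  obtain ⟨w, hw, hw1⟩ := hz
  rw [Subgroup.ne_bot_iff_exists_ne_one]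
  refine ⟨⟨w, fun i j => ?_⟩, fun h => hw1 (congrArg Subtype.val h)⟩
  have h1 := unipotentHom_sub_one_mem (k := ℂ) w i j
  have hmap := map_unipotentHom (evalRingHom z) X w
  rw [coe_evalRingHom, eval_X, hw, Units.val_one] at hmap
  have h2 : (X - C z) ∣ ((unipotentHom (X : ℂ[X]) w : Matrix (Fin 2) (Fin 2) ℂ[X]) - 1) i j := by
    rw [dvd_iff_isRoot, IsRoot, Matrix.sub_apply, eval_sub]
    have h3 := congrFun (congrFun hmap i) j
    rw [Matrix.map_apply] at h3
    refine sub_eq_zero.2 (Eq.trans h3 ?_)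
    rw [Matrix.one_apply, Matrix.one_apply]
    split_ifs <;> simp
  rw [Matrix.smul_apply, smul_eq_mul]
  refine IsCoprime.mul_dvd ?_ h2 h1
  have hc : IsCoprime (X - C z) (X : ℂ[X]) := by
    simpa using isCoprime_X_sub_C_of_isUnit_sub (a := z) (b := 0) (by simpa using hz0)
  fin_cases i <;> fin_cases j <;> simp [wordPattern, hc, isCoprime_one_right]

theorem levelSubgroup_prod_ne_bot (s : Multiset ℂ) (hs : ∀ z ∈ s, ¬ IsFreePoint z) :
    levelSubgroup (s.map fun z => X - C z).prod ≠ ⊥ := by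
  induction s using Multiset.induction_on with
  | empty =>
    rw [Multiset.map_zero, Multiset.prod_zero, levelSubgroup_one]
    exact top_ne_bot
  | cons z s ih =>
    rw [Multiset.map_cons, Multiset.prod_cons]
    exact ne_bot_of_le_ne_bot (commutator_ne_bot _ _
      (levelSubgroup_X_sub_C_ne_bot (hs z (Multiset.mem_cons_self z s)))
      (ih fun y hy => hs y (Multiset.mem_cons_of_mem hy))) (commutator_levelSubgroup_le _ _)

end Congruence

/-! ### Congruent words become relations; roots become eigenvalues -/

section Necessity

theorem pairHom_eq_one_of_mem_levelSubgroup {k K : Type*} [CommRing k] [IsDomain k] [Ring K]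
    [Algebra k K] {a b : K} (ha : a ^ 2 = 0) (hb : b ^ 2 = 0) {f : k[X]}
    (hf : aeval (a * b) f = 0) {w : FreeGroup (Fin 2)} (hw : w ∈ levelSubgroup f) :
    pairHom a b ha hb w = 1 := by
  obtain ⟨P, Q, R, S, hE, hM⟩ := exists_expansion k ha hb w
  rw [mem_congruenceSubgroup, hM, add_sub_cancel_left] at hw
  have hP : f ∣ P := (mul_dvd_mul_iff_right X_ne_zero).1 (by
    simpa [wordMatrix, wordPattern, mul_comm] using hw 0 0)
  have hQ : f ∣ Q := by simpa [wordMatrix, wordPattern] using hw 0 1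
  have hR : f ∣ R := (mul_dvd_mul_iff_right X_ne_zero).1 (by
    simpa [wordMatrix, wordPattern, mul_comm] using hw 1 0)
  have hS : f ∣ S := (mul_dvd_mul_iff_right X_ne_zero).1 (by
    simpa [wordMatrix, wordPattern, mul_comm] using hw 1 1)
  have key (p : k[X]) (hp : f ∣ p) : aeval (a * b) p = 0 := by
    obtain ⟨q, rfl⟩ := hp
    rw [map_mul, hf, zero_mul]
  ext1
  rw [hE, wordEval, key Q hQ, key R hR, key S hS, map_mul, key P hP]
  simp

/-- Write the minimal polynomial as `(X - z)q`; by minimality `q(x) ≠ 0`, and `q(x)` is an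
eigenvector. -/
theorem hasEigenvalue_mulLeft_of_isRoot_minpoly {k K : Type*} [Field k] [Ring K] [Algebra k K]
    {x : K} (hx : IsIntegral k x) {z : k} (hz : (minpoly k x).IsRoot z) :
    Module.End.HasEigenvalue (LinearMap.mulLeft k x) z := by
  obtain ⟨q, hq⟩ := dvd_iff_isRoot.2 hz
  have hne := minpoly.ne_zero hx
  have hq0 : q ≠ 0 := by rintro rfl; exact hne (by rw [hq, mul_zero])
  have hqx : aeval x q ≠ 0 := by
    intro h
    have h1 := minpoly.degree_le_of_ne_zero k x hq0 h
    rw [hq, degree_mul, degree_X_sub_C, degree_eq_natDegree hq0] at h1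
    norm_cast at h1
    omega
  have h0 := minpoly.aeval k x
  rw [hq, map_mul, map_sub, aeval_X, aeval_C, sub_mul, sub_eq_zero, ← Algebra.smul_def] at h0
  exact Module.End.hasEigenvalue_of_hasEigenvector
    (Module.End.hasEigenvector_iff.2 ⟨Module.End.mem_eigenspace_iff.2 (by simpa using h0), hqx⟩)

end Necessity

/-! ### Passage to `ℚ ⊗ R` and `ℂ ⊗ R` -/

section BaseChange

variable {R : Type*} [Ring R]

theorem includeRight_complex_injective [IsAddTorsionFree R] :
    Function.Injective (Algebra.TensorProduct.includeRight : R →ₐ[ℤ] ℂ ⊗[ℤ] R) := by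
  -- Over `ℤ`, torsion-free modules are flat, so tensoring keeps `ℤ → ℂ` injective.
  have : Module.Flat ℤ R := by
    rw [Module.Flat.flat_iff_torsion_eq_bot_of_isBezout, ← Submodule.isTorsionFree_iff_torsion_eq_bot]
    infer_instance
  exact Algebra.TensorProduct.includeRight_injective (algebraMap ℤ ℂ).injective_int

theorem aeval_eigenvalue_eq_zero {x : R} {z : ℂ} (hz : IsEigenvalue x z) {g : ℤ[X]}
    (hg : aeval x g = 0) : aeval z g = 0 := by
  obtain ⟨v, hv⟩ := Module.End.HasEigenvalue.exists_hasEigenvector hz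
  have h1 : aeval ((1 : ℂ) ⊗ₜ[ℤ] x : ℂ ⊗[ℤ] R) (g.map (algebraMap ℤ ℂ)) = 0 := by
    have h := aeval_algHom_apply (Algebra.TensorProduct.includeRight : R →ₐ[ℤ] ℂ ⊗[ℤ] R) x g
    rw [hg, map_zero] at h
    rw [aeval_map_algebraMap]
    exact h
  have h2 := Module.End.aeval_apply_of_hasEigenvector (p := g.map (algebraMap ℤ ℂ)) hv
  have h3 : aeval (LinearMap.mulLeft ℂ ((1 : ℂ) ⊗ₜ[ℤ] x : ℂ ⊗[ℤ] R)) (g.map (algebraMap ℤ ℂ)) =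
      0 := by
    have h := aeval_algHom_apply (Algebra.lmul ℂ (ℂ ⊗[ℤ] R)) ((1 : ℂ) ⊗ₜ[ℤ] x)
      (g.map (algebraMap ℤ ℂ))
    rw [h1, map_zero] at h
    exact h
  rw [h3, LinearMap.zero_apply, eq_comm, smul_eq_zero, or_iff_left hv.2, eval_map_algebraMap] at h2
  exact h2

theorem eq_zero_of_isTranscendentalOverRat {x : R} (hx : IsTranscendentalOverRat x) {g : ℤ[X]}
    (hg : aeval x g = 0) : g = 0 := by
  have h := aeval_algHom_apply (Algebra.TensorProduct.includeRight : R →ₐ[ℤ] ℚ ⊗[ℤ] R) x g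
  rw [hg, map_zero] at h
  have h1 := (transcendental_iff.1 hx) (g.map (algebraMap ℤ ℚ)) (by
    rw [aeval_map_algebraMap]
    exact h)
  exact (Polynomial.map_eq_zero_iff (algebraMap ℤ ℚ).injective_int).1 h1

theorem IsAlgebraicOverRat.isIntegral_complex {x : R} (hx : IsAlgebraicOverRat x) :
    IsIntegral ℂ ((1 : ℂ) ⊗ₜ[ℤ] x : ℂ ⊗[ℤ] R) := by
  obtain ⟨p, hp, hpx⟩ := hx
  rw [← isAlgebraic_iff_isIntegral]
  refine ⟨p.map (algebraMap ℚ ℂ), (Polynomial.map_ne_zero_iff (algebraMap ℚ ℂ).injective).2 hp, ?_⟩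
  let φ : ℚ ⊗[ℤ] R →ₐ[ℤ] ℂ ⊗[ℤ] R :=
    Algebra.TensorProduct.map ((algebraMap ℚ ℂ).toIntAlgHom) (AlgHom.id ℤ R)
  have h := hom_eval₂ p (algebraMap ℚ (ℚ ⊗[ℤ] R)) φ.toRingHom ((1 : ℚ) ⊗ₜ[ℤ] x)
  rw [← aeval_def, hpx, map_zero] at h
  have hφ : φ.toRingHom.comp (algebraMap ℚ (ℚ ⊗[ℤ] R)) =
      (algebraMap ℂ (ℂ ⊗[ℤ] R)).comp (algebraMap ℚ ℂ) := Subsingleton.elim _ _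
  have hφx : φ.toRingHom ((1 : ℚ) ⊗ₜ[ℤ] x) = (1 : ℂ) ⊗ₜ[ℤ] x := by simp [φ]
  rw [hφ, hφx] at h
  rw [aeval_def, eval₂_map, ← h]

end BaseChange

theorem pairHom_not_injective {R : Type*} [Ring R] [IsAddTorsionFree R] {a b : R}
    (ha : a ^ 2 = 0) (hb : b ^ 2 = 0) (hab : IsAlgebraicOverRat (a * b))
    (h : ∀ z : ℂ, IsEigenvalue (a * b) z → ¬ IsFreePoint z) :
    ¬ Function.Injective (pairHom a b ha hb) := by
  intro hinj
  set ι : R →ₐ[ℤ] ℂ ⊗[ℤ] R := Algebra.TensorProduct.includeRight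
  have ha' : ι a ^ 2 = 0 := by rw [← map_pow, ha, map_zero]
  have hb' : ι b ^ 2 = 0 := by rw [← map_pow, hb, map_zero]
  have hint : IsIntegral ℂ (ι a * ι b) := by
    rw [← map_mul]
    exact hab.isIntegral_complex
  have hne : levelSubgroup (minpoly ℂ (ι a * ι b)) ≠ ⊥ := by
    rw [(IsAlgClosed.splits (minpoly ℂ (ι a * ι b))).eq_prod_roots_of_monic (minpoly.monic hint)]
    refine levelSubgroup_prod_ne_bot _ fun z hz => h z ?_
    have := hasEigenvalue_mulLeft_of_isRoot_minpoly hint (isRoot_of_mem_roots hz)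
    rwa [← map_mul] at this
  obtain ⟨⟨w, hw⟩, hw1⟩ := Subgroup.ne_bot_iff_exists_ne_one.1 hne
  have h1 := pairHom_eq_one_of_mem_levelSubgroup ha' hb' (minpoly.aeval _ _) hw
  have h2 := map_pairHom ι.toRingHom ha hb ha' hb' rfl rfl w
  rw [h1, Units.val_one] at h2
  apply hw1
  ext1
  apply hinj
  ext1
  rw [Subgroup.coe_one, map_one, Units.val_one]
  exact includeRight_complex_injective (h2.trans (map_one ι).symm)

end SquareZero

theorem mainTheorem5 {R : Type*} [Ring R] [IsAddTorsionFree R] (a b : R)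
    (ha : a ^ 2 = 0) (hb : b ^ 2 = 0) :
    SquareZero.IsFreeOfRankTwo
        (Subgroup.closure ({SquareZero.oneAdd a ha, SquareZero.oneAdd b hb} : Set Rˣ)) ↔
      (SquareZero.IsTranscendentalOverRat (a * b) ∨
        (SquareZero.IsAlgebraicOverRat (a * b) ∧
          ∃ z : ℂ, SquareZero.IsEigenvalue (a * b) z ∧ SquareZero.IsFreePoint z)) := by
  rw [SquareZero.isFreeOfRankTwo_closure_oneAdd_iff]
  constructor
  · intro hinj
    refine (em (SquareZero.IsAlgebraicOverRat (a * b))).symm.imp id fun hab => ⟨hab, ?_⟩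
    by_contra! h
    exact SquareZero.pairHom_not_injective ha hb hab h hinj
  · rintro (ht | ⟨-, z, hz, hfree⟩)
    -- Only the zero polynomial annihilates `ab`, so any free point would do.
    · exact SquareZero.pairHom_injective_of_isFreePoint ha hb SquareZero.isFreePoint_four
        fun g hg => by rw [SquareZero.eq_zero_of_isTranscendentalOverRat ht hg, map_zero]
    · exact SquareZero.pairHom_injective_of_isFreePoint ha hb hfree
        fun g hg => SquareZero.aeval_eigenvalue_eq_zero hz hg
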